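/- **Setting.** Let $(X,\mathsf d)$ be a proper metric space (closed bounded sets are compact) with a Borel measure $\mathfrak m$ that is finite on bounded sets and doubling: for every $R>0$ there is $C(R)>0$ such that $0<\mathfrak m(B_{2r}(x))\le C(R)\,\mathfrak m(B_r(x))$ for all $x\in X$ and $0<r\le R$. For $x\in X$, a proper pointed metric space $(Y,\mathsf d_Y,y)$ belongs to $\mathrm{Tan}(X,\mathsf d,x)$ if there are $r_i\downarrow 0$ (that is, $r_i>0$, $r_i\to0$), $\varepsilon_i\to 0$, $R_i\to\infty$ (all positive) and maps $f_i$ from the closed ball of radius $R_i$ about $x$ in $(X,\mathsf d/r_i)$ to the closed ball of radius $R_i$ about $y$ in $Y$ with $f_i(x)=y$, which change distances by at most $\varepsilon_i$ and whose image is $\varepsilon_i$-dense in the target ball. We then say that $(r_i,f_i)$ realizes $(X,\mathsf d/r_i,x)\to(Y,\mathsf d_Y,y)$. Let $E\subset X$ be the set of those $x$ for which it fails that for all $(Y,\mathsf d_Y,y)\in\mathrm{Tan}(X,\mathsf d,x)$ and all $z\in Y$ also $(Y,\mathsf d_Y,z)\in\mathrm{Tan}(X,\mathsf d,x)$. Let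 $\Gamma(X)$ be the set of biLipschitz maps $\gamma:\mathrm{Dom}(\gamma)\to X$ with $\mathrm{Dom}(\gamma)\subset\mathbb R$ non-empty and compact. Write $|d\gamma|(t)=c$ if $\mathsf d(\gamma_{t+s_i},\gamma_{t+\tau_i})/|s_i-\tau_i|\to c$ for all sequences $s_i,\tau_i\to0$ with $t+s_i,t+\tau_i\in\mathrm{Dom}(\gamma)$ for which the intervals $J_i$ with endpoints $t+s_i,t+\tau_i$ shrink nicely to $t$, i.e. there are $\alpha>0$ and $\rho_i>0$ with $J_i\subset B_{\rho_i}(t)$ and $\mathcal L^1(J_i)\ge\alpha\,\mathcal L^1(B_{\rho_i}(t))$. **Statement.** The exceptional set $E$ is $\mathfrak m$-null. Moreover, let $\bar x\in X\setminus E$ and let $\gamma\in\Gamma(X)$ be such that $0\in\mathrm{Dom}(\gamma)$, $\gamma_0=\bar x$, $0$ is a point of density one of $\mathrm{Dom}(\gamma)$, and $|d\gamma|(0)$ exists and is positive. Then for every $(X_\infty,\mathsf d_\infty,\bar x_\infty)\in\mathrm{Tan}(X,\mathsf d,\bar x)$ and every $z\in X_\infty$ there is a line through $z$ that is a limit of $\gamma$: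 there are an isometric embedding $\ell:\mathbb R\to X_\infty$ with $\ell(0)=z$, a pair $(r_i,f_i)$ realizing $(X,\mathsf d/r_i,\bar x)\to(X_\infty,\mathsf d_\infty,z)$, and a dense set $D\subset\mathbb R$ such that for every $t\in D$ one has $r_it\in\mathrm{Dom}(\gamma)$ for all large $i$ and $$\lim_{i\to\infty} f_i(\gamma_{r_it})=\ell\big(|d\gamma|(0)\,t\big).$$ -/

import Mathlib

open MeasureTheory Filter Topology Set
open scoped NNReal ENNReal

universe u v

/-- A Borel measure `m` on a metric space is doubling: for each `R > 0` there is a constant `C`,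
depending only on `R`, with `0 < m (B_{2r}(x)) ≤ C * m (B_r(x))` for all `x` and `0 < r ≤ R`. -/
def IsDoublingMeasure {X : Type u} [MetricSpace X] [MeasurableSpace X] (m : Measure X) : Prop :=
  ∀ R : ℝ, 0 < R → ∃ C : ℝ≥0, 0 < C ∧ ∀ (x : X) (r : ℝ), 0 < r → r ≤ R →
    0 < m (Metric.ball x (2 * r)) ∧ m (Metric.ball x (2 * r)) ≤ C * m (Metric.ball x r)

/-- `f` restricts to an `ε`-isometry from the closed ball of radius `R` about `x` in the rescaled
space `(X, d / r)` to the closed ball of radius `R` about `y` in `Y`, with `f x = y`.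
The closed ball of radius `R` for `d / r` is the closed ball of radius `r * R` for `d`; the values
of `f` outside that ball are irrelevant. -/
structure IsApproxIsometryAtScale {X : Type u} {Y : Type v} [MetricSpace X] [MetricSpace Y]
    (x : X) (y : Y) (r ε R : ℝ) (f : X → Y) : Prop where
  map_base : f x = y
  mapsTo : MapsTo f (Metric.closedBall x (r * R)) (Metric.closedBall y R)
  almost_isometric : ∀ a ∈ Metric.closedBall x (r * R), ∀ b ∈ Metric.closedBall x (r * R),
    |dist a b / r - dist (f a) (f b)| ≤ ε
  almost_surjective : ∀ p ∈ Metric.closedBall y R,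
    ∃ a ∈ Metric.closedBall x (r * R), dist (f a) p ≤ ε

/-- The scales `r i → 0` and the maps `f i` realize the pointed Gromov-Hausdorff convergence
`(X, d / r i, x) ⟶ (Y, d, y)`. -/
structure IsBlowUp {X : Type u} {Y : Type v} [MetricSpace X] [MetricSpace Y]
    (x : X) (y : Y) (r : ℕ → ℝ) (f : ℕ → X → Y) : Prop where
  pos : ∀ i, 0 < r i
  tendsto_zero : Tendsto r atTop (𝓝 0)
  approx : ∃ ε R : ℕ → ℝ, (∀ i, 0 < ε i) ∧ (∀ i, 0 < R i) ∧
    Tendsto ε atTop (𝓝 0) ∧ Tendsto R atTop atTop ∧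
    ∀ i, IsApproxIsometryAtScale x y (r i) (ε i) (R i) (f i)

/-- `(Y, y) ∈ Tan(X, x)`: the pointed space `(Y, y)` is a pointed Gromov-Hausdorff limit of
`(X, d / r i, x)` for some `r i → 0`. (To be used for proper `Y`.) -/
def IsTangentSpace {X : Type u} {Y : Type v} [MetricSpace X] [MetricSpace Y]
    (x : X) (y : Y) : Prop :=
  ∃ (r : ℕ → ℝ) (f : ℕ → X → Y), IsBlowUp x y r f

/-- The exceptional set for the change of base point: the points `x` at which it is not true that
for all tangent spaces `(Y, y) ∈ Tan(X, x)` and all `z : Y` also `(Y, z) ∈ Tan(X, x)`. -/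
def exceptionalSet (X : Type u) [MetricSpace X] : Set X :=
  {x | ¬ ∀ (Y : Type v) [MetricSpace Y] [ProperSpace Y] (y : Y),
    IsTangentSpace x y → ∀ z : Y, IsTangentSpace x z}

/-- An element of `Γ(X)`: a biLipschitz map to `X` from a nonempty compact set `dom ⊆ ℝ`.
Only the values of `toFun` on `dom` are meaningful. -/
structure BiLipCurve (X : Type u) [MetricSpace X] where
  dom : Set ℝ
  toFun : ℝ → X
  dom_nonempty : dom.Nonempty
  dom_compact : IsCompact dom
  biLipschitz : ∃ L : ℝ, 0 < L ∧ ∀ s ∈ dom, ∀ t ∈ dom,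
    L⁻¹ * |s - t| ≤ dist (toFun s) (toFun t) ∧ dist (toFun s) (toFun t) ≤ L * |s - t|

/-- The sets `E i ⊆ ℝ` shrink nicely to `x`. -/
def ShrinksNicely (E : ℕ → Set ℝ) (x : ℝ) : Prop :=
  ∃ (ρ : ℕ → ℝ) (α : ℝ), 0 < α ∧ ∀ i, 0 < ρ i ∧ E i ⊆ Metric.ball x (ρ i) ∧
    ENNReal.ofReal α * volume (Metric.ball x (ρ i)) ≤ volume (E i)

/-- `t` is a point of density one of `I ⊆ ℝ`. -/
def IsDensityOnePoint (I : Set ℝ) (t : ℝ) : Prop :=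
  Tendsto (fun ρ : ℝ => volume (I ∩ Metric.ball t ρ) / volume (Metric.ball t ρ))
    (𝓝[>] 0) (𝓝 1)

namespace BiLipCurve

/-- `γ` is metric differentiable at `t` with `|dγ|(t) = c`: one has
`d(γ_{t+s}, γ_{t+τ}) / |s - τ| → c` along all sequences `s, τ → 0` for which the interval with
endpoints `t + s`, `t + τ` (in the domain of `γ`) shrinks nicely to `t`. -/
def HasMetricDifferentialAt {X : Type u} [MetricSpace X] (γ : BiLipCurve X) (t c : ℝ) : Prop :=
  t ∈ γ.dom ∧ ∀ s τ : ℕ → ℝ, Tendsto s atTop (𝓝 0) → Tendsto τ atTop (𝓝 0) →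
    (∀ i, t + s i ∈ γ.dom) → (∀ i, t + τ i ∈ γ.dom) →
    ShrinksNicely (fun i => uIcc (t + s i) (t + τ i)) t →
    Tendsto (fun i => dist (γ.toFun (t + s i)) (γ.toFun (t + τ i)) / |s i - τ i|) atTop (𝓝 c)

/-- The curve `c : ℝ → Y` is a limit of `γ` under some blow-up
`(X, d / r i, γ_0) ⟶ (Y, d, z)` with maps `f i`: on a dense set of times `t`, the rescaled curve
`f i (γ_{r i * t})` is defined for large `i` and converges to `c t`. (For continuous `c`, these
values determine `c`.) -/
def HasLimitCurve {X : Type u} {Y : Type v} [MetricSpace X] [MetricSpace Y]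
    (γ : BiLipCurve X) (z : Y) (c : ℝ → Y) : Prop :=
  ∃ (r : ℕ → ℝ) (f : ℕ → X → Y), IsBlowUp (γ.toFun 0) z r f ∧
    ∃ D : Set ℝ, Dense D ∧ ∀ t ∈ D, (∀ᶠ i in atTop, r i * t ∈ γ.dom) ∧
      Tendsto (fun i => f i (γ.toFun (r i * t))) atTop (𝓝 (c t))

end BiLipCurve

/-!
Two pointed rescalings of metric spaces are compared by correspondences of small distortion, and
every pointed rescaling `(X, d / s, w)` is close to those of a countable dense family of pairs
`(w, s)`. If `(Y, z)` is not a tangent space at `x` although `(Y, y)` is one, then some member of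
this family, close to `(Y, z)`, is far from `(X, d / r, x)` for all small `r`, while it is close to
`(X, d / r, x')` for suitable `x'` with `d(x, x') = O(r)` and arbitrarily small `r`. Let `S` be the
set of points from which this member is far at all small scales. Then `x ∈ S`, but `S` misses the
ball of radius `η r` about `x'`, so `x` is not a Lebesgue density point of `S`. Such points form a
null set for each of the countably many sets `S`.

For the second claim, change the base point to `z`. At a density point of `dom γ`, almost every time
survives the rescaling by a subsequence of the scales, and a further subsequence makes the rescaled
curves converge on a countable dense set of times. Metric differentiability says that the limit
multiplies distances by `c`, so it extends to a line run at speed `c`.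
-/

/-! ### Pointed correspondences -/

section PointedClose

variable {X Y Z : Type*} [PseudoMetricSpace X] [PseudoMetricSpace Y] [PseudoMetricSpace Z]

/-- `T` is a correspondence between the balls of radius `R` in the pointed rescaled spaces
`(X, d / r, x)` and `(Y, d / s, y)` which has distortion at most `ε` and relates the base points.
The partner of a point of one ball may lie outside the other ball. -/
structure IsPointedCorrespondence (x : X) (r : ℝ) (y : Y) (s ε R : ℝ) (T : X → Y → Prop) :
    Prop where
  base : T x y
  distortion : ∀ {a a' : X} {p p' : Y}, T a p → T a' p' → |dist a a' / r - dist p p' / s| ≤ ε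
  exists_right : ∀ a, dist a x / r ≤ R → ∃ p, T a p
  exists_left : ∀ p, dist p y / s ≤ R → ∃ a, T a p

/-- The pointed rescaled spaces `(X, d / r, x)` and `(Y, d / s, y)` are `ε`-close on balls of
radius `R` in the pointed Gromov-Hausdorff sense. -/
def PointedClose (x : X) (r : ℝ) (y : Y) (s ε R : ℝ) : Prop :=
  ∃ T, IsPointedCorrespondence x r y s ε R T

namespace PointedClose

variable {x : X} {y : Y} {z : Z} {r s t ε ε' R R' R'' : ℝ}

theorem nonneg (h : PointedClose x r y s ε R) : 0 ≤ ε :=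
  let ⟨_, hT⟩ := h
  (abs_nonneg _).trans (hT.distortion hT.base hT.base)

theorem symm (h : PointedClose x r y s ε R) : PointedClose y s x r ε R := by
  obtain ⟨T, hT⟩ := h
  refine ⟨fun p a => T a p, hT.base, fun h h' => ?_, hT.exists_left, hT.exists_right⟩
  rw [abs_sub_comm]
  exact hT.distortion h h'

theorem mono (h : PointedClose x r y s ε R) (hε : ε ≤ ε') (hR : R' ≤ R) :
    PointedClose x r y s ε' R' := by
  obtain ⟨T, hT⟩ := h
  exact ⟨T, hT.base, fun h h' => (hT.distortion h h').trans hε,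
    fun a ha => hT.exists_right a (ha.trans hR), fun p hp => hT.exists_left p (hp.trans hR)⟩

theorem trans (h : PointedClose x r y s ε R) (h' : PointedClose y s z t ε' R')
    (hR : R'' + ε' ≤ R) (hR' : R'' + ε ≤ R') : PointedClose x r z t (ε + ε') R'' := by
  have hε := h.nonneg
  have hε' := h'.nonneg
  obtain ⟨T, hT⟩ := h
  obtain ⟨T', hT'⟩ := h'
  refine ⟨fun a q => ∃ p, T a p ∧ T' p q, ⟨y, hT.base, hT'.base⟩, ?_, fun a ha => ?_,
    fun q hq => ?_⟩
  · rintro a a' q q' ⟨p, h, h'⟩ ⟨p', k, k'⟩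
    exact (abs_sub_le _ _ _).trans (add_le_add (hT.distortion h k) (hT'.distortion h' k'))
  · obtain ⟨p, hp⟩ := hT.exists_right a (by linarith)
    obtain ⟨q, hq⟩ := hT'.exists_right p (by linarith [(abs_le.1 (hT.distortion hp hT.base)).1])
    exact ⟨q, p, hp, hq⟩
  · obtain ⟨p, hp⟩ := hT'.exists_left q (by linarith)
    obtain ⟨a, ha⟩ := hT.exists_left p (by linarith [(abs_le.1 (hT'.distortion hp hT'.base)).2])
    exact ⟨a, p, ha, hp⟩

theorem of_dist_le {x' : X} (hr : 0 ≤ r) (h : dist x x' / r ≤ ε) (R : ℝ) :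
    PointedClose x r x' r ε R := by
  have hε : 0 ≤ ε := (div_nonneg dist_nonneg hr).trans h
  have hbase : ∀ b, |dist x b / r - dist x' b / r| ≤ ε := fun b => by
    rw [← sub_div, abs_div, abs_of_nonneg hr]
    exact (div_le_div_of_nonneg_right (abs_dist_sub_le x x' b) hr).trans h
  refine ⟨fun a b => a = b ∨ (a = x ∧ b = x'), Or.inr ⟨rfl, rfl⟩, ?_, fun a _ => ⟨a, Or.inl rfl⟩,
    fun a _ => ⟨a, Or.inl rfl⟩⟩
  rintro a a' p p' (rfl | ⟨rfl, rfl⟩) (rfl | ⟨rfl, rfl⟩)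
  · simpa using hε
  · simpa only [dist_comm a] using hbase a
  · exact hbase _
  · simpa using hε

theorem of_scale_near (hr : 0 < r) (hs : 0 < s) (hR : 0 ≤ R)
    (h : 2 * (max r s * R) * |r⁻¹ - s⁻¹| ≤ ε) (x : X) : PointedClose x r x s ε R := by
  refine ⟨fun a b => a = b ∧ dist a x ≤ max r s * R, ⟨rfl, ?_⟩, ?_, fun a ha => ⟨a, rfl, ?_⟩,
    fun a ha => ⟨a, rfl, ?_⟩⟩
  · rw [dist_self]
    positivity
  · rintro a a' _ _ ⟨rfl, ha⟩ ⟨rfl, ha'⟩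
    rw [div_eq_mul_inv, div_eq_mul_inv, ← mul_sub, abs_mul, abs_of_nonneg dist_nonneg]
    refine (mul_le_mul_of_nonneg_right ?_ (abs_nonneg _)).trans h
    linarith [dist_triangle_right a a' x]
  · exact ((div_le_iff₀' hr).1 ha).trans (mul_le_mul_of_nonneg_right (le_max_left _ _) hR)
  · exact ((div_le_iff₀' hs).1 ha).trans (mul_le_mul_of_nonneg_right (le_max_right _ _) hR)

end PointedClose

theorem eventually_pointedClose_nhds (x : X) {r ε R : ℝ} (hr : 0 < r) (hε : 0 < ε) (hR : 0 ≤ R) :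
    ∀ᶠ q : X × ℝ in 𝓝 (x, r), PointedClose q.1 q.2 x r ε R := by
  have hsnd : ContinuousAt (Prod.snd : X × ℝ → ℝ) (x, r) := continuousAt_snd
  have hbase : ContinuousAt (fun q : X × ℝ => dist q.1 x / q.2) (x, r) :=
    (continuousAt_fst.dist continuousAt_const).div hsnd hr.ne'
  have hscale : ContinuousAt
      (fun q : X × ℝ => 2 * (max q.2 r * (R + ε)) * |q.2⁻¹ - r⁻¹|) (x, r) := by
    have hinv := hsnd.inv₀ hr.ne'
    exact ((hsnd.max continuousAt_const).mul_const _ |>.const_mul _).mul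
      (hinv.sub continuousAt_const).abs
  filter_upwards [hsnd.eventually_const_lt hr,
    hbase.eventually_lt_const (u := ε / 2) (by simpa using hε),
    hscale.eventually_lt_const (u := ε / 2) (by simpa using hε)] with q hq hqx hqr
  refine ((PointedClose.of_dist_le hq.le hqx.le (R + ε)).trans
    (.of_scale_near hq hr (by positivity) hqr.le x) ?_ ?_).mono (add_halves ε).le le_rfl
    <;> linarith

end PointedClose

/-! ### Tangent spaces and correspondences -/

section Tangent

variable {X : Type u} {Y : Type v} [MetricSpace X] [MetricSpace Y] {x : X} {y z : Y}

theorem IsApproxIsometryAtScale.mono {r ε ε' R : ℝ} {f : X → Y}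
    (hf : IsApproxIsometryAtScale x y r ε R f) (hε : ε ≤ ε') :
    IsApproxIsometryAtScale x y r ε' R f where
  map_base := hf.map_base
  mapsTo := hf.mapsTo
  almost_isometric a ha b hb := (hf.almost_isometric a ha b hb).trans hε
  almost_surjective p hp :=
    let ⟨a, ha, hap⟩ := hf.almost_surjective p hp
    ⟨a, ha, hap.trans hε⟩

theorem IsApproxIsometryAtScale.exists_pointedClose {r ε R : ℝ} {f : X → Y}
    (hf : IsApproxIsometryAtScale x y r ε R f) (hr : 0 < r) (hz : dist y z ≤ R) :
    ∃ x', dist x x' / r ≤ dist y z + 2 * ε ∧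
      PointedClose x' r z 1 (3 * ε) (R - (dist y z + 2 * ε)) := by
  have hR : 0 ≤ R := dist_nonneg.trans hz
  have hx : x ∈ Metric.closedBall x (r * R) := Metric.mem_closedBall_self (by positivity)
  have hε : 0 ≤ ε := (abs_nonneg _).trans (hf.almost_isometric x hx x hx)
  obtain ⟨x', hx', hx'z⟩ := hf.almost_surjective z (Metric.mem_closedBall'.2 hz)
  have hxx' : dist x x' / r ≤ dist y z + 2 * ε := by
    have hdist := (abs_le.1 (hf.almost_isometric x hx x' hx')).2
    rw [hf.map_base] at hdist
    linarith [dist_triangle y z (f x'), dist_comm z (f x')]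
  refine ⟨x', hxx', fun a p => a ∈ Metric.closedBall x (r * R) ∧ dist (f a) p ≤ ε, ⟨hx', hx'z⟩,
    ?_, fun a ha => ⟨f a, ?_, (dist_self _).trans_le hε⟩, fun p hp => hf.almost_surjective p ?_⟩
  · rintro a a' p p' ⟨ha, hp⟩ ⟨ha', hp'⟩
    have hdist := hf.almost_isometric a ha a' ha'
    have himage : |dist (f a) (f a') - dist p p'| ≤ 2 * ε := by
      rw [← Real.dist_eq]
      exact (dist_dist_dist_le _ _ _ _).trans (by linarith)
    rw [div_one]
    exact (abs_sub_le _ _ _).trans ((add_le_add hdist himage).trans_eq (by ring))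
  · have htri : dist a x / r ≤ dist a x' / r + dist x x' / r := by
      rw [← add_div]
      gcongr
      exact dist_triangle_right a x x'
    rw [Metric.mem_closedBall, ← div_le_iff₀' hr]
    linarith
  · rw [div_one] at hp
    rw [Metric.mem_closedBall]
    linarith [dist_triangle_right p y z]

theorem IsBlowUp.eventually_exists_pointedClose {r : ℕ → ℝ} {f : ℕ → X → Y}
    (h : IsBlowUp x y r f) (z : Y) {ε : ℝ} (hε : 0 < ε) (R : ℝ) :
    ∀ᶠ i in atTop, ∃ x', dist x x' ≤ (dist y z + 1) * r i ∧ PointedClose x' (r i) z 1 ε R := by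
  obtain ⟨e, S, -, -, he, hS, hf⟩ := h.approx
  filter_upwards [he.eventually_lt_const (u := ε / 3) (by positivity),
    he.eventually_lt_const (u := 1 / 2) (by positivity),
    hS.eventually_ge_atTop (dist y z), hS.eventually_ge_atTop (R + dist y z + 1)]
    with i hiε hi1 hiz hiR
  obtain ⟨x', hx', hclose⟩ := (hf i).exists_pointedClose (h.pos i) hiz
  refine ⟨x', (div_le_iff₀ (h.pos i)).1 (hx'.trans ?_), hclose.mono ?_ ?_⟩ <;> linarith

theorem exists_closedBall_subset_thickening {Y : Type*} [PseudoMetricSpace Y] [ProperSpace Y]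
    (z : Y) (R : ℝ) {ε : ℝ} (hε : 0 < ε) :
    ∃ δ > 0, Metric.closedBall z (R + δ) ⊆ Metric.thickening ε (Metric.closedBall z R) := by
  have hK : IsCompact (Metric.closedBall z (R + 1) \ Metric.thickening ε (Metric.closedBall z R)) :=
    (isCompact_closedBall z _).diff Metric.isOpen_thickening
  obtain ⟨R', hRR', hR'⟩ := hK.exists_forall_le' (f := fun p => dist p z) (a := R) (by fun_prop)
    fun p hp => lt_of_not_ge fun h => hp.2 (Metric.self_subset_thickening hε _ h)
  refine ⟨min 1 ((R' - R) / 2), by have := sub_pos.2 hRR'; positivity, fun p hp => ?_⟩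
  rw [Metric.mem_closedBall] at hp
  by_contra hpε
  have := hR' p ⟨hp.trans (by gcongr; exact min_le_left _ _), hpε⟩
  linarith [min_le_right 1 ((R' - R) / 2)]

/-- Partners of points of the ball of radius `R` may lie slightly outside the corresponding ball;
`hball` allows to move them back inside. -/
theorem PointedClose.exists_isApproxIsometryAtScale {r e η ε R : ℝ}
    (h : PointedClose x r z 1 e R) (hr : 0 < r) (hR : 0 ≤ R) (hε : 0 ≤ ε) (heη : e ≤ η)
    (hball : Metric.closedBall z (R + η) ⊆ Metric.thickening ε (Metric.closedBall z (R - η))) :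
    ∃ f : X → Y, IsApproxIsometryAtScale x z r (e + 2 * ε) R f := by
  have hη : 0 ≤ η := h.nonneg.trans heη
  obtain ⟨T, hT⟩ := h
  have hdist : ∀ {a a' p p'}, T a p → T a' p' → |dist a a' / r - dist p p'| ≤ e :=
    fun hp hp' => by simpa only [div_one] using hT.distortion hp hp'
  have himage : ∀ a ∈ Metric.closedBall x (r * R), ∃ q ∈ Metric.closedBall z R, (a = x → q = z) ∧
      ∃ p, T a p ∧ dist p q ≤ ε := fun a ha => by
    rcases eq_or_ne a x with rfl | hax
    · exact ⟨z, Metric.mem_closedBall_self hR, fun _ => rfl, z, hT.base, (dist_self z).trans_le hε⟩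
    · have ha' : dist a x / r ≤ R := (div_le_iff₀' hr).2 ha
      obtain ⟨p, hp⟩ := hT.exists_right a ha'
      obtain ⟨q, hq, hpq⟩ := Metric.mem_thickening_iff.1 <| hball <| Metric.mem_closedBall.2 <| by
        linarith [(abs_le.1 (hdist hp hT.base)).1]
      exact ⟨q, Metric.closedBall_subset_closedBall (by linarith) hq, fun h => absurd h hax,
        p, hp, hpq.le⟩
  have : Nonempty Y := ⟨z⟩
  choose! f hfR hfx hf using himage
  refine ⟨f, hfx x (Metric.mem_closedBall_self (by positivity)) rfl, hfR, fun a ha b hb => ?_,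
    fun p hp => ?_⟩
  · obtain ⟨p, hap, hpf⟩ := hf a ha
    obtain ⟨q, hbq, hqf⟩ := hf b hb
    have hmove : |dist p q - dist (f a) (f b)| ≤ 2 * ε := by
      rw [← Real.dist_eq]
      exact (dist_dist_dist_le _ _ _ _).trans (by linarith)
    exact (abs_sub_le _ _ _).trans (add_le_add (hdist hap hbq) hmove)
  · obtain ⟨p', hp', hpp'⟩ := Metric.mem_thickening_iff.1 <| hball <|
      Metric.closedBall_subset_closedBall (by linarith) hp
    rw [Metric.mem_closedBall] at hp'
    obtain ⟨a, hap'⟩ := hT.exists_left p' (by rw [div_one]; linarith)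
    have ha : a ∈ Metric.closedBall x (r * R) := (div_le_iff₀' hr).1 <| by
      linarith [(abs_le.1 (hdist hap' hT.base)).2]
    obtain ⟨q, haq, hqf⟩ := hf a ha
    have hqp' : dist q p' ≤ e := by simpa using hdist haq hap'
    refine ⟨a, ha, ?_⟩
    linarith [dist_triangle4 (f a) q p' p, dist_comm q (f a), dist_comm p p']

theorem exists_frequently_isApproxIsometryAtScale [ProperSpace Y]
    (h : ∀ ε > 0, ∀ R, ∃ᶠ r in 𝓝[>] 0, PointedClose x r z 1 ε R) {ε R₀ : ℝ} (hε : 0 < ε)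
    (hR₀ : 0 ≤ R₀) :
    ∃ R > R₀, ∃ᶠ r in 𝓝[>] 0, ∃ f : X → Y, IsApproxIsometryAtScale x z r ε R f := by
  obtain ⟨δ, hδ, hball⟩ := exists_closedBall_subset_thickening z R₀ (ε := ε / 4) (by positivity)
  refine ⟨R₀ + δ / 2, by linarith,
    ((h (min (δ / 2) (ε / 2)) (by positivity) (R₀ + δ / 2)).and_eventually
      self_mem_nhdsWithin).mono fun r ⟨hclose, hr⟩ => ?_⟩
  obtain ⟨f, hf⟩ := hclose.exists_isApproxIsometryAtScale hr (by positivity) (by positivity)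
    (min_le_left _ _) (ε := ε / 4) (by simpa only [add_assoc, add_halves, add_sub_cancel_right])
  exact ⟨f, hf.mono (by linarith [min_le_right (δ / 2) (ε / 2)])⟩

theorem isTangentSpace_of_frequently_pointedClose [ProperSpace Y]
    (h : ∀ ε > 0, ∀ R, ∃ᶠ r in 𝓝[>] 0, PointedClose x r z 1 ε R) : IsTangentSpace x z := by
  have hpos : ∀ n : ℕ, (0 : ℝ) < 1 / (n + 1) := fun n => Nat.one_div_pos_of_nat
  choose R hR hfreq using fun n : ℕ =>
    exists_frequently_isApproxIsometryAtScale h (hpos n) n.cast_nonneg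
  choose r hrf hr using fun n => ((hfreq n).and_eventually (Ioo_mem_nhdsGT (hpos n))).exists
  choose f hf using hrf
  have hlim := tendsto_one_div_add_atTop_nhds_zero_nat (𝕜 := ℝ)
  exact ⟨r, f, fun n => (hr n).1,
    squeeze_zero (fun n => (hr n).1.le) (fun n => (hr n).2.le) hlim,
    _, R, hpos, fun n => n.cast_nonneg.trans_lt (hR n), hlim,
    tendsto_atTop_mono (fun n => (hR n).le) tendsto_natCast_atTop_atTop, hf⟩

end Tangent

/-! ### The exceptional set is null -/

section Null

variable {X : Type u} [MetricSpace X]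

/-- The set `S` comes closer than any multiple of `r` to all points at distance `O(r)` from `x`, as
`r → 0`. This is the metric consequence of `x` being a density point of `S`. -/
def IsAsymptoticallyDenseAt {X : Type*} [PseudoMetricSpace X] (S : Set X) (x : X) : Prop :=
  ∀ C η : ℝ, 0 < η → ∀ᶠ r in 𝓝[>] 0, ∀ y, dist x y ≤ C * r → ∃ a ∈ S, dist a y ≤ η * r

theorem ae_mem_imp_isAsymptoticallyDenseAt {X : Type*} [PseudoMetricSpace X]
    [SecondCountableTopology X] [MeasurableSpace X] [BorelSpace X] (m : Measure X)
    [IsLocallyFiniteMeasure m] [IsUnifLocDoublingMeasure m] (S : Set X) :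
    ∀ᵐ x ∂m, x ∈ S → IsAsymptoticallyDenseAt S x := by
  refine ae_imp_of_ae_restrict ?_
  filter_upwards [ae_all_iff.2 fun K : ℕ =>
    IsUnifLocDoublingMeasure.ae_tendsto_measure_inter_div m S K] with x hx C η hη
  obtain ⟨K, hK⟩ := exists_nat_ge (C / η)
  let l : Filter (X × ℝ) := (⊤ ×ˢ 𝓝[>] 0) ⊓ 𝓟 {p | dist x p.1 ≤ C * p.2}
  have hsnd : Tendsto Prod.snd l (𝓝[>] 0) := tendsto_snd.mono_left inf_le_left
  have hδ : Tendsto (fun p : X × ℝ => η * p.2) l (𝓝[>] 0) := by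
    simpa only [mul_zero] using TendstoNhdsWithinIoi.const_mul hη hsnd
  have hmem : ∀ᶠ p in l, x ∈ Metric.closedBall p.1 (K * (η * p.2)) := by
    filter_upwards [hsnd.eventually self_mem_nhdsWithin, mem_inf_of_right (mem_principal_self _)]
      with p hp hxp
    rw [Metric.mem_closedBall, ← mul_assoc]
    exact hxp.trans (mul_le_mul_of_nonneg_right ((div_le_iff₀ hη).1 hK) (mem_Ioi.1 hp).le)
  have hne : ∀ᶠ p : X × ℝ in l, (S ∩ Metric.closedBall p.1 (η * p.2)).Nonempty := by
    filter_upwards [(hx K _ _ hδ hmem).eventually_ne one_ne_zero] with p hp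
    refine nonempty_of_measure_ne_zero (μ := m) fun h => hp ?_
    rw [h, ENNReal.zero_div]
  rw [eventually_inf_principal, top_prod, eventually_comap] at hne
  filter_upwards [hne] with r hr y hy
  exact hr (y, r) rfl hy

/-- The points from which the pointed space `(X, d / q.2, q.1)` is not seen, up to precision
`1 / (n + 1)` on the ball of radius `n`, at any scale below `1 / (n + 1)`. -/
def unseenSet {X : Type*} [PseudoMetricSpace X] (q : X × ℝ) (n : ℕ) : Set X :=
  {x | ∀ r ∈ Ioo (0 : ℝ) (1 / (n + 1)), ¬ PointedClose x r q.1 q.2 (1 / (n + 1)) n}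

theorem IsTangentSpace.exists_mem_pointedClose {Y : Type v} [MetricSpace Y] {x : X} {y : Y}
    (hy : IsTangentSpace x y) {Q : Set (X × ℝ)} (hQ : Dense Q) (z : Y) {ε : ℝ} (hε : 0 < ε)
    (R : ℝ) : ∃ q ∈ Q, PointedClose q.1 q.2 z 1 ε R := by
  obtain ⟨r, f, hrf⟩ := hy
  obtain ⟨i, x', -, hx'⟩ := (hrf.eventually_exists_pointedClose z (half_pos hε) (|R| + ε)).exists
  obtain ⟨q, hqQ, hq⟩ := hQ.inter_nhds_nonempty <|
    eventually_pointedClose_nhds x' (R := |R| + ε) (hrf.pos i) (half_pos hε) (by positivity)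
  refine ⟨q, hqQ, (hq.trans hx' ?_ ?_).mono (add_halves ε).le le_rfl⟩ <;>
    linarith [le_abs_self R]

theorem IsBlowUp.tendsto_nhdsGT {Y : Type v} [MetricSpace Y] {x : X} {y : Y} {r : ℕ → ℝ}
    {f : ℕ → X → Y} (h : IsBlowUp x y r f) : Tendsto r atTop (𝓝[>] 0) :=
  tendsto_nhdsWithin_iff.2 ⟨h.tendsto_zero, .of_forall h.pos⟩

theorem IsTangentSpace.not_isAsymptoticallyDenseAt_unseenSet {Y : Type v} [MetricSpace Y]
    {x : X} {y z : Y} (hy : IsTangentSpace x y) {q : X × ℝ} {n : ℕ} {e R : ℝ}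
    (hq : PointedClose q.1 q.2 z 1 e R) (he : 3 * e < 1 / (n + 1)) (hR : n + 1 < R) :
    ¬ IsAsymptoticallyDenseAt (unseenSet q n) x := by
  intro hdense
  obtain ⟨r, f, hrf⟩ := hy
  have hε : (0 : ℝ) < 1 / (n + 1) := Nat.one_div_pos_of_nat
  have hε1 : (1 : ℝ) / (n + 1) ≤ 1 := (div_le_one₀ (by positivity)).2 (by simp)
  set ε : ℝ := 1 / (n + 1)
  have hr := hrf.tendsto_nhdsGT
  obtain ⟨i, hdense, ⟨x', hxx', hx'⟩, hi⟩ :=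
    ((hr.eventually (hdense (dist y z + 1) (ε / 3) (by positivity))).and
      ((hrf.eventually_exists_pointedClose z (ε := ε / 3) (by positivity) (n + 2)).and
        (hr.eventually (Ioo_mem_nhdsGT hε)))).exists
  obtain ⟨a, ha, hax'⟩ := hdense x' hxx'
  have hclose : PointedClose a (r i) z 1 (ε / 3 + ε / 3) (n + 1) :=
    (PointedClose.of_dist_le hi.1.le ((div_le_iff₀ hi.1).2 hax') (n + 3)).trans hx'
      (by linarith) (by linarith)
  exact ha (r i) hi
    ((hclose.trans hq.symm (by linarith) (by linarith)).mono (by linarith) le_rfl)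

theorem IsTangentSpace.change_base {Y : Type v} [MetricSpace Y] [ProperSpace Y] {x : X} {y : Y}
    (hy : IsTangentSpace x y) {Q : Set (X × ℝ)} (hQ : Dense Q)
    (hx : ∀ q ∈ Q, ∀ n, x ∈ unseenSet q n → IsAsymptoticallyDenseAt (unseenSet q n) x) (z : Y) :
    IsTangentSpace x z := by
  refine isTangentSpace_of_frequently_pointedClose fun ε hε R => ?_
  by_contra hfar
  obtain ⟨δ, hδ, hfar⟩ := mem_nhdsGT_iff_exists_Ioo_subset.1 (not_frequently.1 hfar)
  have hlim := tendsto_one_div_add_atTop_nhds_zero_nat (𝕜 := ℝ)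
  obtain ⟨n, hnδ, hnε, hnR⟩ := ((hlim.eventually_lt_const hδ).and
    ((hlim.eventually_lt_const (half_pos hε)).and
      (tendsto_natCast_atTop_atTop.eventually_ge_atTop (R + ε)))).exists
  have hn : (0 : ℝ) < 1 / (n + 1) := Nat.one_div_pos_of_nat
  obtain ⟨q, hqQ, hq⟩ := hy.exists_mem_pointedClose hQ z (ε := 1 / (n + 1) / 4) (by positivity)
    (n + 2)
  refine hy.not_isAsymptoticallyDenseAt_unseenSet hq (by linarith) (by linarith)
    (hx q hqQ n fun r hr hxq => hfar ⟨hr.1, hr.2.trans hnδ⟩ ?_)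
  exact (hxq.trans hq (by linarith) (by linarith)).mono (by linarith) le_rfl

theorem measure_exceptionalSet [SecondCountableTopology X] [MeasurableSpace X] [BorelSpace X]
    (m : Measure X) [IsLocallyFiniteMeasure m] [IsUnifLocDoublingMeasure m] :
    m (exceptionalSet.{u, v} X) = 0 := by
  obtain ⟨Q, hQc, hQ⟩ := TopologicalSpace.exists_countable_dense (X × ℝ)
  have hdense : ∀ᵐ x ∂m, ∀ q ∈ Q, ∀ n, x ∈ unseenSet q n →
      IsAsymptoticallyDenseAt (unseenSet q n) x :=
    (ae_ball_iff hQc).2 fun q _ => ae_all_iff.2 fun n => ae_mem_imp_isAsymptoticallyDenseAt m _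
  rw [measure_eq_zero_iff_ae_notMem]
  filter_upwards [hdense] with x hx
  exact not_not.2 fun Y _ _ y hy z => hy.change_base hQ hx z

end Null

/-! ### Limits of curves -/

section BlowUp

variable {X : Type u} {Y : Type v} [MetricSpace X] [MetricSpace Y] {x : X} {y : Y} {r : ℕ → ℝ}
  {f : ℕ → X → Y}

theorem IsBlowUp.comp_tendsto (h : IsBlowUp x y r f) {φ : ℕ → ℕ} (hφ : Tendsto φ atTop atTop) :
    IsBlowUp x y (r ∘ φ) (f ∘ φ) := by
  obtain ⟨e, R, he₀, hR₀, he, hR, hf⟩ := h.approx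
  exact ⟨fun i => h.pos _, h.tendsto_zero.comp hφ, e ∘ φ, R ∘ φ, fun i => he₀ _, fun i => hR₀ _,
    he.comp hφ, hR.comp hφ, fun i => hf _⟩

theorem IsBlowUp.map_base (h : IsBlowUp x y r f) (i : ℕ) : f i x = y :=
  let ⟨_, _, _, _, _, _, hf⟩ := h.approx
  (hf i).map_base

theorem IsBlowUp.tendsto_dist_sub (h : IsBlowUp x y r f) {a b : ℕ → X}
    (ha : IsBoundedUnder (· ≤ ·) atTop fun i => dist (a i) x / r i)
    (hb : IsBoundedUnder (· ≤ ·) atTop fun i => dist (b i) x / r i) :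
    Tendsto (fun i => dist (a i) (b i) / r i - dist (f i (a i)) (f i (b i))) atTop (𝓝 0) := by
  obtain ⟨A, hA⟩ := ha
  obtain ⟨B, hB⟩ := hb
  obtain ⟨e, R, -, -, he, hR, hf⟩ := h.approx
  refine squeeze_zero_norm' ?_ he
  filter_upwards [eventually_map.1 hA, eventually_map.1 hB, hR.eventually_ge_atTop A,
    hR.eventually_ge_atTop B] with i hiA hiB hAR hBR
  exact (hf i).almost_isometric _ ((div_le_iff₀' (h.pos i)).1 (hiA.trans hAR)) _
    ((div_le_iff₀' (h.pos i)).1 (hiB.trans hBR))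

end BlowUp

section DensityPoint

theorem exists_subseq_ae_eventually_notMem {α : Type*} {_ : MeasurableSpace α} {μ : Measure α}
    {s : ℕ → ℕ → Set α} (h : ∀ n, Tendsto (fun i => μ (s n i)) atTop (𝓝 0)) :
    ∃ φ : ℕ → ℕ, StrictMono φ ∧ ∀ᵐ x ∂μ, ∀ᶠ n in atTop, x ∉ s n (φ n) := by
  obtain ⟨φ, hφ, hs⟩ := extraction_forall_of_eventually fun n =>
    (h n).eventually_lt_const (ENNReal.pow_pos (ENNReal.inv_pos.2 ENNReal.ofNat_ne_top) n :
      (0 : ℝ≥0∞) < 2⁻¹ ^ n)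
  refine ⟨φ, hφ, ae_eventually_notMem (ne_top_of_le_ne_top (b := 2) (by simp) ?_)⟩
  calc ∑' n, μ (s n (φ n)) ≤ ∑' n, 2⁻¹ ^ n := ENNReal.tsum_le_tsum fun n => (hs n).le
    _ = 2 := by rw [ENNReal.tsum_geometric, ENNReal.one_sub_inv_two, inv_inv]

variable {I : Set ℝ} {t : ℝ}

theorem IsDensityOnePoint.tendsto_measure_diff (hI : MeasurableSet I) (h : IsDensityOnePoint I t) :
    Tendsto (fun ρ : ℝ => volume (Metric.ball t ρ \ I) / volume (Metric.ball t ρ))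
      (𝓝[>] 0) (𝓝 0) := by
  have hsub := ENNReal.Tendsto.sub tendsto_const_nhds h (.inl ENNReal.one_ne_top)
  rw [tsub_self] at hsub
  refine hsub.congr' ?_
  filter_upwards [self_mem_nhdsWithin] with ρ hρ
  have hpos : volume (Metric.ball t ρ) ≠ 0 := (Metric.measure_ball_pos volume t hρ).ne'
  have hfin : volume (Metric.ball t ρ) ≠ ∞ := measure_ball_lt_top.ne
  rw [← sdiff_inter_self_eq_sdiff, measure_sdiff inter_subset_right
    (hI.inter measurableSet_ball).nullMeasurableSet
    (measure_ne_top_of_subset inter_subset_right hfin), ENNReal.sub_div fun _ _ => hpos,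
    ENNReal.div_self hpos hfin]

theorem IsDensityOnePoint.tendsto_measure_rescaled_diff (hI : MeasurableSet I)
    (h : IsDensityOnePoint I t) {M : ℝ} (hM : 0 < M) :
    Tendsto (fun ρ : ℝ => volume {u ∈ Metric.ball 0 M | t + ρ * u ∉ I}) (𝓝[>] 0) (𝓝 0) := by
  have hscale : Tendsto (fun ρ : ℝ => M * ρ) (𝓝[>] 0) (𝓝[>] 0) := by
    simpa only [mul_zero, id] using
      TendstoNhdsWithinIoi.const_mul hM (tendsto_id (x := 𝓝[>] (0 : ℝ)))
  have hlim := ENNReal.Tendsto.mul_const (b := ENNReal.ofReal (2 * M))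
    ((h.tendsto_measure_diff hI).comp hscale) (.inr ENNReal.ofReal_ne_top)
  rw [zero_mul] at hlim
  refine hlim.congr' ?_
  filter_upwards [self_mem_nhdsWithin] with ρ hρ
  rw [mem_Ioi] at hρ
  have hset : {u ∈ Metric.ball 0 M | t + ρ * u ∉ I} =
      (ρ * ·) ⁻¹' ((t + ·) ⁻¹' (Metric.ball t (M * ρ) \ I)) := by
    ext u
    simp [abs_of_pos hρ, mul_comm M, mul_lt_mul_iff_right₀ hρ]
  rw [hset, Real.volume_preimage_mul_left hρ.ne', measure_preimage_add, Function.comp_apply,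
    Real.volume_ball, ENNReal.div_eq_inv_mul, mul_right_comm, abs_of_pos (inv_pos.2 hρ),
    ← ENNReal.ofReal_inv_of_pos (by positivity), ← ENNReal.ofReal_mul (by positivity)]
  congr 2
  field_simp

theorem IsDensityOnePoint.exists_subseq_ae_eventually_mem (hI : MeasurableSet I)
    (h : IsDensityOnePoint I t) {r : ℕ → ℝ} (hr : Tendsto r atTop (𝓝[>] 0)) :
    ∃ φ : ℕ → ℕ, StrictMono φ ∧ ∀ᵐ u : ℝ, ∀ᶠ i in atTop, t + r (φ i) * u ∈ I := by
  obtain ⟨φ, hφ, hmem⟩ := exists_subseq_ae_eventually_notMem fun n : ℕ =>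
    (h.tendsto_measure_rescaled_diff hI n.cast_add_one_pos).comp hr
  refine ⟨φ, hφ, hmem.mono fun u hu => ?_⟩
  filter_upwards [hu, tendsto_natCast_atTop_atTop.eventually_ge_atTop |u|] with n hn hun
  by_contra hnI
  exact hn ⟨mem_ball_zero_iff.2 (hun.trans_lt (lt_add_one _)), hnI⟩

end DensityPoint

theorem shrinksNicely_uIcc (t : ℝ) {a b : ℝ} (hab : a ≠ b) {r : ℕ → ℝ} (hr : ∀ i, 0 < r i) :
    ShrinksNicely (fun i => uIcc (t + r i * a) (t + r i * b)) t := by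
  have hab' : 0 < |a - b| := abs_pos.2 (sub_ne_zero.2 hab)
  have hM : 0 < |a| + |b| + 1 := by positivity
  set M := |a| + |b| + 1
  have hmem : ∀ i u, |u| < M → t + r i * u ∈ Metric.ball t (r i * M) := fun i u hu => by
    rw [mem_ball_iff_norm, add_sub_cancel_left, Real.norm_eq_abs, abs_mul, abs_of_pos (hr i)]
    exact mul_lt_mul_of_pos_left hu (hr i)
  refine ⟨fun i => r i * M, |a - b| / (2 * M), div_pos hab' (by positivity), fun i => ⟨?_, ?_, ?_⟩⟩
  · exact mul_pos (hr i) hM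
  · exact (convex_ball t _).ordConnected.uIcc_subset
      (hmem i a (by linarith [abs_nonneg b])) (hmem i b (by linarith [abs_nonneg a]))
  · rw [Real.volume_ball, Real.volume_interval, ← ENNReal.ofReal_mul (by positivity),
      add_sub_add_left_eq_sub, ← mul_sub, abs_mul, abs_of_pos (hr i), abs_sub_comm b a]
    refine ENNReal.ofReal_le_ofReal (le_of_eq ?_)
    field_simp

namespace BiLipCurve.HasMetricDifferentialAt

variable {X : Type u} [MetricSpace X] {γ : BiLipCurve X} {t c : ℝ}

theorem tendsto_dist_div (h : γ.HasMetricDifferentialAt t c) {r : ℕ → ℝ} (hr : ∀ i, 0 < r i)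
    (hr₀ : Tendsto r atTop (𝓝 0)) {a b : ℝ} (ha : ∀ᶠ i in atTop, t + r i * a ∈ γ.dom)
    (hb : ∀ᶠ i in atTop, t + r i * b ∈ γ.dom) :
    Tendsto (fun i => dist (γ.toFun (t + r i * a)) (γ.toFun (t + r i * b)) / r i) atTop
      (𝓝 (c * dist a b)) := by
  rcases eq_or_ne a b with rfl | hab
  · simp
  obtain ⟨N, hN⟩ := eventually_atTop.1 (ha.and hb)
  rw [← tendsto_add_atTop_iff_nat N] at hr₀ ⊢
  have hlim := h.2 (fun i => r (i + N) * a) (fun i => r (i + N) * b)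
    (by simpa only [zero_mul] using hr₀.mul_const a)
    (by simpa only [zero_mul] using hr₀.mul_const b)
    (fun i => (hN (i + N) (by lia)).1) (fun i => (hN (i + N) (by lia)).2)
    (shrinksNicely_uIcc t hab fun i => hr (i + N))
  refine (hlim.mul_const (dist a b)).congr fun i => ?_
  have hri := hr (i + N)
  have hab' : |a - b| ≠ 0 := abs_ne_zero.2 (sub_ne_zero.2 hab)
  rw [← mul_sub, abs_mul, abs_of_pos hri, Real.dist_eq]
  field_simp

theorem tendsto_dist_blowUp {Y : Type v} [MetricSpace Y] {z : Y}
    (h : γ.HasMetricDifferentialAt 0 c) {r : ℕ → ℝ} {f : ℕ → X → Y}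
    (hrf : IsBlowUp (γ.toFun 0) z r f) {a b : ℝ} (ha : ∀ᶠ i in atTop, r i * a ∈ γ.dom)
    (hb : ∀ᶠ i in atTop, r i * b ∈ γ.dom) :
    Tendsto (fun i => dist (f i (γ.toFun (r i * a))) (f i (γ.toFun (r i * b)))) atTop
      (𝓝 (c * dist a b)) := by
  have hlim : ∀ {a b : ℝ}, (∀ᶠ i in atTop, r i * a ∈ γ.dom) → (∀ᶠ i in atTop, r i * b ∈ γ.dom) →
      Tendsto (fun i => dist (γ.toFun (r i * a)) (γ.toFun (r i * b)) / r i) atTop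
        (𝓝 (c * dist a b)) := fun ha hb => by
    simpa only [zero_add] using h.tendsto_dist_div hrf.pos hrf.tendsto_zero
      (by simpa only [zero_add] using ha) (by simpa only [zero_add] using hb)
  have hbdd : ∀ {a : ℝ}, (∀ᶠ i in atTop, r i * a ∈ γ.dom) →
      IsBoundedUnder (· ≤ ·) atTop fun i => dist (γ.toFun (r i * a)) (γ.toFun 0) / r i :=
    fun ha => by
      have hzero : ∀ᶠ i in atTop, r i * 0 ∈ γ.dom := .of_forall fun i => by simpa using h.1
      simpa only [mul_zero] using (hlim ha hzero).isBoundedUnder_le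
  simpa only [sub_sub_cancel, sub_zero] using
    (hlim ha hb).sub (hrf.tendsto_dist_sub (hbdd ha) (hbdd hb))

end BiLipCurve.HasMetricDifferentialAt

section Limits

theorem exists_subseq_tendsto_pi {ι Y : Type*} [Countable ι] [TopologicalSpace Y]
    [FirstCountableTopology Y] {F : ℕ → ι → Y}
    (hF : ∀ t, ∃ K, IsCompact K ∧ ∀ᶠ i in atTop, F i t ∈ K) :
    ∃ φ : ℕ → ℕ, StrictMono φ ∧ ∃ g, Tendsto (F ∘ φ) atTop (𝓝 g) := by
  classical
  choose K hK hFK using hF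
  have hne : ∀ t, ∃ p, p ∈ K t := fun t => (hFK t).exists.imp' (F · t) fun _ => id
  choose p hp using hne
  let G : ℕ → ι → Y := fun i t => if F i t ∈ K t then F i t else p t
  have hG : ∀ i, G i ∈ univ.pi K := fun i t _ => by
    simp only [G]
    split_ifs with h
    exacts [h, hp t]
  obtain ⟨g, -, φ, hφ, hlim⟩ := (isCompact_univ_pi hK).tendsto_subseq hG
  refine ⟨φ, hφ, g, tendsto_pi_nhds.2 fun t => ((tendsto_pi_nhds.1 hlim) t).congr' ?_⟩
  filter_upwards [hφ.tendsto_atTop.eventually (hFK t)] with i hi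
  exact if_pos hi

theorem exists_dist_eq_mul_extension {α Y : Type*} [PseudoMetricSpace α] [MetricSpace Y]
    [CompleteSpace Y] {D : Set α} (hD : Dense D) {c : ℝ} {g : D → Y}
    (hg : ∀ s t, dist (g s) (g t) = c * dist s t) :
    ∃ G : α → Y, (∀ s t, dist (G s) (G t) = c * dist s t) ∧ ∀ t : D, G t = g t := by
  have hind : IsUniformInducing ((↑) : D → α) := isUniformInducing_val D
  have hguc : UniformContinuous g :=
    (LipschitzWith.of_dist_le' fun s t => (hg s t).le).uniformContinuous
  have hG := (uniformContinuous_uniformly_extend hind hD.denseRange_val hguc).continuous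
  have hGg := uniformly_extend_of_ind hind hD.denseRange_val hguc
  refine ⟨_, fun s t => hD.denseRange_val.induction_on₂ (isClosed_eq ?_ ?_) (fun s t => ?_) s t,
    hGg⟩
  · exact (hG.comp continuous_fst).dist (hG.comp continuous_snd)
  · fun_prop
  · rw [hGg, hGg]
    exact hg s t

theorem exists_isometry_comp_const_mul {Y : Type*} [MetricSpace Y] [CompleteSpace Y] {D : Set ℝ}
    (hD : Dense D) {c : ℝ} (hc : 0 < c) {g : D → Y}
    (hg : ∀ s t, dist (g s) (g t) = c * dist s t) :
    ∃ l : ℝ → Y, Isometry l ∧ ∀ t : D, l (c * t) = g t := by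
  obtain ⟨G, hG, hGg⟩ := exists_dist_eq_mul_extension hD hg
  refine ⟨fun u => G (c⁻¹ * u), .of_dist_eq fun s t => ?_, fun t => ?_⟩
  · rw [hG, Real.dist_eq, Real.dist_eq, ← mul_sub, abs_mul, abs_of_pos (inv_pos.2 hc),
      mul_inv_cancel_left₀ hc.ne']
  · simp only [inv_mul_cancel_left₀ hc.ne', hGg]

end Limits

theorem BiLipCurve.exists_line_hasLimitCurve {X : Type u} [MetricSpace X] (γ : BiLipCurve X)
    (hdens : IsDensityOnePoint γ.dom 0) {c : ℝ} (hγ : γ.HasMetricDifferentialAt 0 c) (hc : 0 < c)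
    {Y : Type v} [MetricSpace Y] [ProperSpace Y] {z : Y} (hz : IsTangentSpace (γ.toFun 0) z) :
    ∃ l : ℝ → Y, Isometry l ∧ l 0 = z ∧ γ.HasLimitCurve z (fun t => l (c * t)) := by
  obtain ⟨r₀, f₀, hrf₀⟩ := hz
  obtain ⟨φ, hφ, hae⟩ :=
    hdens.exists_subseq_ae_eventually_mem γ.dom_compact.measurableSet hrf₀.tendsto_nhdsGT
  have hrf₁ := hrf₀.comp_tendsto hφ.tendsto_atTop
  simp only [zero_add] at hae
  obtain ⟨D₀, hD₀dom, hD₀c, hD₀⟩ := (Measure.dense_of_ae hae).exists_countable_dense_subset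
  set D := insert 0 D₀
  have hD : Dense D := hD₀.mono (subset_insert _ _)
  have : Countable D := (hD₀c.insert 0).to_subtype
  have hzero : ∀ i, (r₀ ∘ φ) i * 0 ∈ γ.dom := fun i => by simpa only [mul_zero] using hγ.1
  have hdom₁ : ∀ t ∈ D, ∀ᶠ i in atTop, (r₀ ∘ φ) i * t ∈ γ.dom :=
    forall_mem_insert.2 ⟨.of_forall hzero, hD₀dom⟩
  have hbase : ∀ i, (f₀ ∘ φ) i (γ.toFun ((r₀ ∘ φ) i * 0)) = z := fun i => by
    rw [mul_zero, hrf₁.map_base]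
  obtain ⟨ψ, hψ, g, hg⟩ := exists_subseq_tendsto_pi
    (F := fun i (t : D) => (f₀ ∘ φ) i (γ.toFun ((r₀ ∘ φ) i * t))) fun t =>
      ⟨Metric.closedBall z (c * dist (t : ℝ) 0 + 1), isCompact_closedBall _ _, by
        filter_upwards [(hγ.tendsto_dist_blowUp hrf₁ (hdom₁ t t.2)
          (.of_forall hzero)).eventually_le_const (lt_add_one _)] with i hi
        rwa [hbase] at hi⟩
  have hrf := hrf₁.comp_tendsto hψ.tendsto_atTop
  have hdom : ∀ t ∈ D, ∀ᶠ i in atTop, ((r₀ ∘ φ) ∘ ψ) i * t ∈ γ.dom := fun t ht =>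
    hψ.tendsto_atTop.eventually (hdom₁ t ht)
  rw [tendsto_pi_nhds] at hg
  obtain ⟨l, hl, hlg⟩ := exists_isometry_comp_const_mul hD hc fun s t =>
    tendsto_nhds_unique ((hg s).dist (hg t))
      (hγ.tendsto_dist_blowUp hrf (hdom s s.2) (hdom t t.2))
  have hl₀ : l 0 = z := by
    rw [← mul_zero c, hlg ⟨0, mem_insert _ _⟩]
    exact tendsto_nhds_unique (hg _) (tendsto_const_nhds.congr fun i => (hbase _).symm)
  refine ⟨l, hl, hl₀, _, _, hrf, D, hD, fun t ht => ⟨hdom t ht, ?_⟩⟩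
  simp only [hlg ⟨t, ht⟩]
  exact hg ⟨t, ht⟩

theorem IsDoublingMeasure.isUnifLocDoublingMeasure {X : Type u} [MetricSpace X]
    [MeasurableSpace X] {m : Measure X} (hm : IsDoublingMeasure m) :
    IsUnifLocDoublingMeasure m := by
  obtain ⟨C, -, hC⟩ := hm 2 two_pos
  refine ⟨C * C, ?_⟩
  filter_upwards [Ioc_mem_nhdsGT zero_lt_one] with r hr x
  have houter := (hC x (2 * r) (by linarith [hr.1]) (by linarith [hr.2])).2
  have hinner := (hC x r hr.1 (by linarith [hr.2])).2
  calc m (Metric.closedBall x (2 * r)) ≤ m (Metric.ball x (2 * (2 * r))) :=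
        measure_mono (Metric.closedBall_subset_ball (by linarith [hr.1]))
    _ ≤ C * (C * m (Metric.ball x r)) := houter.trans (by gcongr)
    _ ≤ C * (C * m (Metric.closedBall x r)) := by gcongr; exact Metric.ball_subset_closedBall
    _ = ↑(C * C) * m (Metric.closedBall x r) := by rw [ENNReal.coe_mul, mul_assoc]

theorem corollary3p10_general {X : Type u} [MetricSpace X] [SecondCountableTopology X]
    [MeasurableSpace X] [BorelSpace X] (m : Measure X) [IsLocallyFiniteMeasure m]
    [IsUnifLocDoublingMeasure m] :
    m (exceptionalSet.{u, v} X) = 0 ∧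
    ∀ x : X, x ∉ exceptionalSet.{u, v} X →
    ∀ γ : BiLipCurve X, γ.toFun 0 = x → IsDensityOnePoint γ.dom 0 →
    ∀ c : ℝ, γ.HasMetricDifferentialAt 0 c → 0 < c →
    ∀ (Y : Type v) [MetricSpace Y] [ProperSpace Y] (y : Y), IsTangentSpace x y →
    ∀ z : Y, ∃ l : ℝ → Y, Isometry l ∧ l 0 = z ∧ γ.HasLimitCurve z (fun t => l (c * t)) := by
  refine ⟨measure_exceptionalSet m, ?_⟩
  rintro x hx γ rfl hdens c hγ hc Y _ _ y hy z
  exact γ.exists_line_hasLimitCurve hdens hγ hc (not_not.1 hx Y y hy z)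

theorem corollary3p10 {X : Type u} [MetricSpace X] [ProperSpace X] [MeasurableSpace X]
    [BorelSpace X] (m : Measure X) [IsFiniteMeasureOnCompacts m] (hm : IsDoublingMeasure m) :
    m (exceptionalSet.{u, v} X) = 0 ∧
    ∀ x : X, x ∉ exceptionalSet.{u, v} X →
    ∀ γ : BiLipCurve X, 0 ∈ γ.dom → γ.toFun 0 = x → IsDensityOnePoint γ.dom 0 →
    ∀ c : ℝ, γ.HasMetricDifferentialAt 0 c → 0 < c →
    ∀ (Y : Type v) [MetricSpace Y] [ProperSpace Y] (y : Y), IsTangentSpace x y →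
    ∀ z : Y, ∃ l : ℝ → Y, Isometry l ∧ l 0 = z ∧ γ.HasLimitCurve z (fun t => l (c * t)) := by
  have := hm.isUnifLocDoublingMeasure
  exact (corollary3p10_general m).imp_right fun h x hx γ _ => h x hx γ
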